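/- Let $\Omega\subset\mathbb R^2$ be open, let $b:\Omega\to\mathbb R$ be locally Lipschitz, and let $\mathbf A=(A_1,A_2)$ be a $C^1$ vector potential on $\Omega$, $\partial_1A_2-\partial_2A_1=b$. The magnetic dynamics is the Hamiltonian flow $\dot q=\partial_p\mathcal H$, $\dot p=-\partial_q\mathcal H$ of $\mathcal H(q,p)=\tfrac12\|p-\mathbf A(q)\|^2$. Let $\mathcal C$ be a connected component of $\partial\Omega$ that is a $C^2$ closed curve without self-intersections, of length $L$, with arc length parametrization $\gamma:\mathbb R/L\mathbb Z\to\mathcal C$ oriented so that the inward unit normal $N(s)$ is $\gamma'(s)$ rotated by $+\pi/2$. Let $\kappa$ be the signed curvature, $\gamma''=\kappa N$; assume that $\kappa$ is differentiable with bounded derivative, and put $K=\sup|\kappa|$, $K'=\sup|\kappa'|$. Let $\epsilon\in(0,1)$ and $0<\delta\le\epsilon/K$, and suppose that $\psi(n,s)=\gamma(s)+nN(s)$ is a bijection (hence a $C^1$ diffeomorphism) from $(0,\delta)\times\mathbb R/L\mathbb Z$ onto $\Omega_{\mathcal C}(\delta)=\{q\in\Omega:\ d(q,\mathcal C)<\delta\}$.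 Put $$B(n,s)=-b(\psi(n,s))(1-n\kappa(s)),\qquad f(n)=-\frac1L\int_n^\delta\int_0^L B(\eta,\xi)\,d\xi\,d\eta\quad(0<n\le\delta),$$ where the integrals are assumed to converge, and assume that there is $M\ge0$ with $$\Big|B(n,s)-\frac1L\int_0^LB(n,\xi)\,d\xi\Big|\le M\qquad\text{for all }(n,s)\in(0,\delta)\times\mathbb R/L\mathbb Z.$$ Let $T>0$ and let $q(t)=\psi(n(t),s(t))$, $t\in[0,T]$, be a trajectory contained in $\Omega_{\mathcal C}(\delta)$, with energy $H_0$. Put $$C(T)=\Big|\dot s(0)\,[1-\kappa(s(0))n(0)]^2-\frac1L\int_{n(0)}^\delta\int_0^LB(\eta,\xi)\,d\xi\,d\eta\Big|+\sqrt{2H_0}\,(1+\epsilon)+\Big(M\sqrt{2H_0}+\frac{2H_0K'\delta}{1-\epsilon}\Big)T$$ and assume that $\liminf_{n\to0^+}|f(n)|>C(T)$ (the lower limit may be $+\infty$). Then there exist continuous strictly decreasing functions $g:(0,\delta]\to\mathbb R$ such that $$\lim_{n\to0^+}g(n)=\liminf_{n\to0^+}|f(n)|,\qquad g\le|f|\ \text{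 on }(0,\delta],$$ and every such $g$ takes the value $C(T)$ and satisfies, for all $t\in[0,T)$, $$n(t)\ge g^{-1}(C(T)),\qquad\text{with } n(t)>g^{-1}(C(T))\ \text{ if } H_0>0.$$ -/

import Mathlib

open Set Filter Topology MeasureTheory

namespace MagneticConfinement

noncomputable section

/-- The Euclidean plane. -/
abbrev Plane : Type := EuclideanSpace ℝ (Fin 2)

/-! ### The magnetic Hamiltonian dynamics -/

/-- `A` is a `C¹` vector potential on `Ω` of the magnetic field `b dq₁ ∧ dq₂`, that is
`d(A₁ dq₁ + A₂ dq₂) = b dq₁ ∧ dq₂`, i.e. `∂₁A₂ - ∂₂A₁ = b` on `Ω`. -/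
def IsVectorPotential (Ω : Set Plane) (b : Plane → ℝ) (A : Plane → Plane) : Prop :=
  ContDiffOn ℝ 1 A Ω ∧
    ∀ q ∈ Ω, fderiv ℝ A q !₂[1, 0] 1 - fderiv ℝ A q !₂[0, 1] 0 = b q

/-- The magnetic Hamiltonian `‖p - A(q)‖² / 2`. -/
def hamiltonian (A : Plane → Plane) (q p : Plane) : ℝ :=
  ‖p - A q‖ ^ 2 / 2

/-- `(q, p)` solves Hamilton's equations `q' = ∂_p H`, `p' = -∂_q H` on the time interval `[0, T]`
(one-sided derivatives at the end points). -/
def IsTrajectory (A : Plane → Plane) (T : ℝ) (q p : ℝ → Plane) : Prop :=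
  ∀ t ∈ Icc 0 T,
    HasDerivWithinAt q (gradient (fun y => hamiltonian A (q t) y) (p t)) (Icc 0 T) t ∧
    HasDerivWithinAt p (-gradient (fun x => hamiltonian A x (p t)) (q t)) (Icc 0 T) t

/-! ### Boundary curves and tubular coordinates -/

/-- `γ` is an `L`-periodic `C²` arc length parametrization of the closed curve `C` without
self-intersections. -/
structure IsArcLengthParam (γ : ℝ → Plane) (L : ℝ) (C : Set Plane) : Prop where
  length_pos : 0 < L
  contDiff : ContDiff ℝ 2 γ
  periodic : Function.Periodic γ L
  unit_speed : ∀ s, ‖deriv γ s‖ = 1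
  injOn : InjOn γ (Ico 0 L)
  range_eq : range γ = C

/-- `C` is a connected component of the boundary of `Ω`. -/
def IsBoundaryComponent (Ω C : Set Plane) : Prop :=
  ∃ x ∈ frontier Ω, C = connectedComponentIn (frontier Ω) x

/-- The unit normal to `γ`: the unit tangent rotated by `+π/2`, so that `(γ', N)` is a direct
orthonormal frame. It is the inward normal when `γ` runs with `Ω` on its left. -/
def normal (γ : ℝ → Plane) (s : ℝ) : Plane :=
  !₂[-(deriv γ s 1), deriv γ s 0]

/-- The signed curvature `κ` of an arc length parametrized curve: `γ'' = κ N`. -/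
def curvature (γ : ℝ → Plane) (s : ℝ) : ℝ :=
  inner ℝ (deriv (deriv γ) s) (normal γ s)

/-- The tubular coordinate map `ψ(n, s) = γ(s) + n N(s)`. -/
def tube (γ : ℝ → Plane) (n s : ℝ) : Plane :=
  γ s + n • normal γ s

/-- The collar of the points of `Ω` at distance less than `δ` from `C`. -/
def collar (Ω C : Set Plane) (δ : ℝ) : Set Plane :=
  {q | q ∈ Ω ∧ Metric.infDist q C < δ}

/-- `(n, s)` are coordinates on the collar of width `δ`: `ψ` is a bijection from
`(0, δ) × ℝ/Lℤ` onto the collar. (Since its values lie in `Ω`, the normal is the inward one.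
Where `|κ| n < 1` the differential of `ψ` is invertible, so such a bijection is automatically a
diffeomorphism.) -/
def IsTubular (Ω C : Set Plane) (γ : ℝ → Plane) (L δ : ℝ) : Prop :=
  BijOn (fun x : ℝ × ℝ => tube γ x.1 x.2) (Ioo 0 δ ×ˢ Ico 0 L) (collar Ω C δ)

/-- The magnetic field in tubular coordinates, `B(n, s) = -b(ψ(n, s)) (1 - n κ(s))`. -/
def tubularField (b : Plane → ℝ) (γ : ℝ → Plane) (n s : ℝ) : ℝ :=
  -b (tube γ n s) * (1 - n * curvature γ s)

/-- `f(n) = -(1/L) ∫_n^δ ∫_0^L B(η, ξ) dξ dη`. -/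
def flux (b : Plane → ℝ) (γ : ℝ → Plane) (L δ n : ℝ) : ℝ :=
  -(1 / L) * ∫ η in n..δ, ∫ ξ in (0 : ℝ)..L, tubularField b γ η ξ

/-- `liminf_{n → 0⁺} |f(n)|`, an element of `[0, +∞]`. -/
def liminfFlux (b : Plane → ℝ) (γ : ℝ → Plane) (L δ : ℝ) : EReal :=
  liminf (fun n => ((|flux b γ L δ n| : ℝ) : EReal)) (𝓝[>] 0)

/-- The constant `C(T)`, where `n₀, s₀, v₀` stand for `n(0), s(0), s'(0)`. -/
def confinementConst (b : Plane → ℝ) (γ : ℝ → Plane) (L δ ε M H₀ n₀ s₀ v₀ T : ℝ) : ℝ :=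
  |v₀ * (1 - curvature γ s₀ * n₀) ^ 2
      - (1 / L) * ∫ η in n₀..δ, ∫ ξ in (0 : ℝ)..L, tubularField b γ η ξ|
    + √(2 * H₀) * (1 + ε)
    + (M * √(2 * H₀) + 2 * H₀ * (⨆ s, |deriv (curvature γ) s|) * δ / (1 - ε)) * T

/-- `g` is a continuous strictly decreasing function on `(0, δ]` with `g ≤ |f|` and
`lim_{n → 0} g(n) = liminf_{n → 0} |f(n)|` (possibly `+∞`). -/
structure IsMinorant (b : Plane → ℝ) (γ : ℝ → Plane) (L δ : ℝ) (g : ℝ → ℝ) : Prop where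
  continuousOn : ContinuousOn g (Ioc 0 δ)
  strictAntiOn : StrictAntiOn g (Ioc 0 δ)
  le_abs : ∀ n ∈ Ioc 0 δ, g n ≤ |flux b γ L δ n|
  tendsto : Tendsto (fun n => (g n : EReal)) (𝓝[>] 0) (𝓝 (liminfFlux b γ L δ))

end

end MagneticConfinement

open MagneticConfinement

/-!
In the collar the motion is `q' = v`, `v' = -b J v` with `‖v‖ = √(2H₀)`. Its angular momentum
`s' (1 - n κ)²` changes at the rate `-B(n, s) n' - n κ'(s) ⟪γ', v⟫² / (1 - n κ)`, whereas
`d/dt f(n) = B̄(n) n'` for the mean `B̄` of `B` over the parallel curve at distance `n`. So the sum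
of the two drifts only at the rate `(B̄ - B) n' - n κ' ⟪γ', v⟫² / (1 - n κ)`, which is bounded.
Since the angular momentum itself is at most `√(2H₀) (1 + |n κ|)`, it follows that
`|f(n(t))| ≤ C(T)`, strictly if `H₀ > 0`. A decreasing `g ≤ |f|` turns this into a lower bound
for `n(t)`.
-/

namespace MagneticConfinement

noncomputable section

section Minorant

/-- The Pasch–Hausdorff envelope of `G` for the one-sided cost `max (y - x) 0`: the largest
antitone `1`-Lipschitz function below `G`. -/
def antitoneEnvelope (G : ℝ → ℝ) (x : ℝ) : ℝ :=
  ⨅ y, (G y + max (y - x) 0)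

variable {G : ℝ → ℝ}

theorem bddBelow_range_add_max (hG : BddBelow (range G)) (x : ℝ) :
    BddBelow (range fun y => G y + max (y - x) 0) := by
  obtain ⟨c, hc⟩ := hG
  refine ⟨c, ?_⟩
  rintro _ ⟨y, rfl⟩
  exact le_add_of_le_of_nonneg (hc (mem_range_self y)) (le_max_right _ _)

theorem antitoneEnvelope_le (hG : BddBelow (range G)) {x y : ℝ} (hyx : y ≤ x) :
    antitoneEnvelope G x ≤ G y :=
  (ciInf_le (bddBelow_range_add_max hG x) y).trans_eq <| by
    rw [max_eq_right (sub_nonpos.2 hyx), add_zero]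

theorem antitone_antitoneEnvelope (hG : BddBelow (range G)) : Antitone (antitoneEnvelope G) :=
  fun x x' hxx' => ciInf_mono (bddBelow_range_add_max hG x') fun y => by gcongr

theorem lipschitzWith_antitoneEnvelope (hG : BddBelow (range G)) :
    LipschitzWith 1 (antitoneEnvelope G) := by
  refine LipschitzWith.of_le_add fun x x' => ?_
  rw [← sub_le_iff_le_add]
  refine le_ciInf fun y => sub_le_iff_le_add.2 ?_
  have hcost : max (y - x) 0 ≤ max (y - x') 0 + dist x x' := by
    rw [Real.dist_eq]
    rcases max_cases (y - x) 0 with h | h <;> rcases max_cases (y - x') 0 with h' | h' <;>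
      linarith [neg_abs_le (x - x'), abs_nonneg (x - x')]
  calc antitoneEnvelope G x ≤ G y + max (y - x) 0 := ciInf_le (bddBelow_range_add_max hG x) y
    _ ≤ G y + max (y - x') 0 + dist x x' := by linarith

theorem eventually_le_antitoneEnvelope (hG : BddBelow (range G)) {c : ℝ}
    (hc : ∀ᶠ x in atBot, c ≤ G x) : ∀ᶠ x in atBot, c ≤ antitoneEnvelope G x := by
  obtain ⟨a, ha⟩ := hG
  obtain ⟨r, hr⟩ := eventually_atBot.1 hc
  filter_upwards [eventually_le_atBot (r - (c - a))] with x hx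
  refine le_ciInf fun y => ?_
  rcases le_total y r with hyr | hry
  · exact le_add_of_le_of_nonneg (hr y hyr) (le_max_right _ _)
  · linarith [ha (mem_range_self y), le_max_left (y - x) 0]

theorem tendsto_antitoneEnvelope_atBot (hG : BddBelow (range G)) :
    Tendsto (fun x => (antitoneEnvelope G x : EReal)) atBot
      (𝓝 (liminf (fun x => (G x : EReal)) atBot)) := by
  refine tendsto_order.2 ⟨fun a ha => ?_, fun a ha => ?_⟩
  · obtain ⟨c, hac, hc⟩ := EReal.exists_between_coe_real ha
    have hcG : ∀ᶠ x in atBot, c ≤ G x :=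
      (eventually_lt_of_lt_liminf hc).mono fun x hx => (EReal.coe_lt_coe_iff.1 hx).le
    filter_upwards [eventually_le_antitoneEnvelope hG hcG] with x hx
    exact hac.trans_le (EReal.coe_le_coe_iff.2 hx)
  · refine Eventually.of_forall fun x => ?_
    obtain ⟨y, hya, hyx⟩ := ((frequently_lt_of_liminf_lt (by isBoundedDefault) ha).and_eventually
      (eventually_le_atBot x)).exists
    exact (EReal.coe_le_coe_iff.2 (antitoneEnvelope_le hG hyx)).trans_lt hya

theorem tendsto_coe_sub_id {h : ℝ → ℝ} {l : EReal}
    (hl : Tendsto (fun n => (h n : EReal)) (𝓝[>] 0) (𝓝 l)) :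
    Tendsto (fun n => ((h n - n : ℝ) : EReal)) (𝓝[>] 0) (𝓝 l) := by
  have hneg : Tendsto (fun n : ℝ => ((-n : ℝ) : EReal)) (𝓝[>] 0) (𝓝 0) := by
    have h0 := (continuous_coe_real_ereal.comp continuous_neg).tendsto (0 : ℝ)
    rw [Function.comp_apply, neg_zero] at h0
    exact h0.mono_left nhdsWithin_le_nhds
  have hadd := (EReal.continuousAt_add (p := (l, 0)) (by simp) (by simp)).tendsto.comp
    (hl.prodMk_nhds hneg)
  simpa [Function.comp_def, sub_eq_add_neg] using hadd

/- In the variable `log n` the envelope is continuous and antitone and has the right limit;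
subtracting `n` makes it strictly decreasing. -/
theorem exists_strictAntiOn_le_tendsto_liminf {F : ℝ → ℝ} (hF : BddBelow (F '' Ioi 0)) :
    ∃ g : ℝ → ℝ, ContinuousOn g (Ioi 0) ∧ StrictAntiOn g (Ioi 0) ∧ (∀ n ∈ Ioi 0, g n ≤ F n) ∧
      Tendsto (fun n => (g n : EReal)) (𝓝[>] 0)
        (𝓝 (liminf (fun n => (F n : EReal)) (𝓝[>] 0))) := by
  have hG : BddBelow (range (F ∘ Real.exp)) := by rwa [range_comp, Real.range_exp]
  refine ⟨fun n => antitoneEnvelope (F ∘ Real.exp) (Real.log n) - n, ?_, ?_, ?_, ?_⟩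
  · exact ((lipschitzWith_antitoneEnvelope hG).continuous.comp_continuousOn
      (Real.continuousOn_log.mono fun n hn => ne_of_gt hn)).sub continuousOn_id
  · intro n hn n' _ hnn'
    have hle := antitone_antitoneEnvelope hG (Real.log_le_log hn hnn'.le)
    dsimp only
    linarith
  · intro n hn
    have hle := antitoneEnvelope_le hG (le_refl (Real.log n))
    rw [Function.comp_apply, Real.exp_log hn] at hle
    exact (sub_le_self _ (le_of_lt hn)).trans hle
  · refine tendsto_coe_sub_id ?_
    have hlim := (tendsto_antitoneEnvelope_atBot hG).comp Real.tendsto_log_nhdsGT_zero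
    rwa [← Real.map_exp_atBot] at hlim ⊢

theorem exists_isMinorant (b : Plane → ℝ) (γ : ℝ → Plane) (L δ : ℝ) :
    ∃ g : ℝ → ℝ, IsMinorant b γ L δ g := by
  have hbdd : BddBelow ((fun n => |flux b γ L δ n|) '' Ioi 0) :=
    ⟨0, forall_mem_image.2 fun n _ => abs_nonneg _⟩
  obtain ⟨g, hcont, hanti, hle, hlim⟩ := exists_strictAntiOn_le_tendsto_liminf hbdd
  exact ⟨g, hcont.mono Ioc_subset_Ioi_self, hanti.mono Ioc_subset_Ioi_self,
    fun n hn => hle n hn.1, hlim⟩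

variable {b : Plane → ℝ} {γ : ℝ → Plane} {L δ : ℝ} {g : ℝ → ℝ}

theorem IsMinorant.exists_eq (hg : IsMinorant b γ L δ g) (hδ : 0 < δ) {c : ℝ} (hc : 0 ≤ c)
    (hlim : (c : EReal) < liminfFlux b γ L δ) : ∃ m ∈ Ioc 0 δ, g m = c := by
  obtain ⟨x, hcx, hx⟩ :=
    ((hg.tendsto.eventually (lt_mem_nhds hlim)).and (Ioc_mem_nhdsGT hδ)).exists
  have hgδ : g δ ≤ c := (hg.le_abs δ ⟨hδ, le_rfl⟩).trans <| by simpa [flux] using hc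
  have hsub : Icc x δ ⊆ Ioc 0 δ := fun y hy => ⟨hx.1.trans_le hy.1, hy.2⟩
  obtain ⟨m, hm, hgm⟩ := intermediate_value_Icc' hx.2 (hg.continuousOn.mono hsub)
    ⟨hgδ, (EReal.coe_lt_coe_iff.1 hcx).le⟩
  exact ⟨m, hsub hm, hgm⟩

theorem IsMinorant.le_of_abs_flux_le (hg : IsMinorant b γ L δ g) {m n : ℝ}
    (hm : m ∈ Ioc 0 δ) (hn : n ∈ Ioc 0 δ) (h : |flux b γ L δ n| ≤ g m) : m ≤ n :=
  (hg.strictAntiOn.le_iff_ge hn hm).1 ((hg.le_abs n hn).trans h)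

theorem IsMinorant.lt_of_abs_flux_lt (hg : IsMinorant b γ L δ g) {m n : ℝ}
    (hm : m ∈ Ioc 0 δ) (hn : n ∈ Ioc 0 δ) (h : |flux b γ L δ n| < g m) : m < n :=
  (hg.strictAntiOn.lt_iff_gt hn hm).1 ((hg.le_abs n hn).trans_lt h)

end Minorant

section Rotation

instance : Fact (Module.finrank ℝ Plane = 2) := ⟨finrank_euclideanSpace_fin⟩

/-- The orientation of the plane for which the standard basis is direct. -/
def planeOrientation : Orientation ℝ Plane (Fin 2) :=
  (EuclideanSpace.basisFun (Fin 2) ℝ).toBasis.orientation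

/-- The rotation of the plane by `+π/2`. -/
abbrev quarterTurn : Plane ≃ₗᵢ[ℝ] Plane := planeOrientation.rightAngleRotation

theorem quarterTurn_apply (v : Plane) : quarterTurn v = !₂[-(v 1), v 0] := by
  refine ext_inner_right ℝ fun w => ?_
  rw [Orientation.inner_rightAngleRotation_left, Orientation.areaForm_to_volumeForm,
    planeOrientation.volumeForm_robust (EuclideanSpace.basisFun (Fin 2) ℝ) rfl]
  simp only [Module.Basis.det_apply, Matrix.det_fin_two, Module.Basis.toMatrix_apply,
    OrthonormalBasis.coe_toBasis_repr_apply, EuclideanSpace.basisFun_repr, PiLp.inner_apply,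
    RCLike.inner_apply, conj_trivial, Fin.sum_univ_two, Matrix.cons_val_zero, Matrix.cons_val_one]
  ring

theorem eq_inner_smul_quarterTurn {u v : Plane} (hu : ‖u‖ = 1) (huv : inner ℝ u v = 0) :
    v = inner ℝ v (quarterTurn u) • quarterTurn u := by
  refine ext_inner_right ℝ fun w => ?_
  have h := planeOrientation.inner_mul_inner_add_areaForm_mul_areaForm u v w
  rw [huv, hu, zero_mul, zero_add, one_pow, one_mul] at h
  rw [real_inner_smul_left, real_inner_comm (quarterTurn u) v,
    Orientation.inner_rightAngleRotation_left, Orientation.inner_rightAngleRotation_left, h]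

theorem inner_map_sub_inner_map (D : Plane →L[ℝ] Plane) (v w : Plane) :
    inner ℝ v (D w) - inner ℝ (D v) w =
      -(D !₂[1, 0] 1 - D !₂[0, 1] 0) * inner ℝ (quarterTurn v) w := by
  have hD (u : Plane) : D u = u 0 • D !₂[1, 0] + u 1 • D !₂[0, 1] := by
    rw [← map_smul, ← map_smul, ← map_add]
    congr 1
    ext i; fin_cases i <;> simp
  rw [hD v, hD w, quarterTurn_apply]
  simp only [PiLp.inner_apply, Fin.sum_univ_two, RCLike.inner_apply, conj_trivial, PiLp.add_apply,
    PiLp.smul_apply, smul_eq_mul, Matrix.cons_val_zero, Matrix.cons_val_one]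
  ring

end Rotation

section Dynamics

/-- Newton's equation of motion on the time set `I`, with velocity `v`, under the Lorentz force
`-b(q) J v` of the magnetic field `b`, where `J` is the rotation by `+π/2`. -/
structure IsMagneticMotion (b : Plane → ℝ) (I : Set ℝ) (q v : ℝ → Plane) : Prop where
  hasDerivWithinAt_position : ∀ t ∈ I, HasDerivWithinAt q (v t) I t
  hasDerivWithinAt_velocity : ∀ t ∈ I, HasDerivWithinAt v (-b (q t) • quarterTurn (v t)) I t

theorem IsVectorPotential.continuousOn {Ω : Set Plane} {b : Plane → ℝ} {A : Plane → Plane}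
    (hA : IsVectorPotential Ω b A) (hΩ : IsOpen Ω) : ContinuousOn b Ω := by
  have hfderiv := hA.1.continuousOn_fderiv_of_isOpen hΩ le_rfl
  have hcurl : ContinuousOn
      (fun q => fderiv ℝ A q !₂[1, 0] 1 - fderiv ℝ A q !₂[0, 1] 0) Ω := by fun_prop
  exact hcurl.congr fun q hq => (hA.2 q hq).symm

section Gradient

variable {E F : Type*} [NormedAddCommGroup E] [InnerProductSpace ℝ E] [CompleteSpace E]
  [NormedAddCommGroup F] [InnerProductSpace ℝ F]

theorem inner_gradient_half_norm_sq {f : E → F} {f' : E →L[ℝ] F} {x : E}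
    (hf : HasFDerivAt f f' x) (w : E) :
    inner ℝ (gradient (fun y => ‖f y‖ ^ 2 / 2) x) w = inner ℝ (f x) (f' w) := by
  have h : HasFDerivAt (fun y => ‖f y‖ ^ 2 / 2) ((innerSL ℝ (f x)).comp f') x :=
    (hf.norm_sq.mul_const (2 : ℝ)⁻¹).congr_fderiv (by ext w; simp)
  rw [inner_gradient_left, h.fderiv, ContinuousLinearMap.comp_apply, innerSL_apply_apply]

end Gradient

theorem gradient_hamiltonian_momentum (A : Plane → Plane) (q p : Plane) :
    gradient (fun y => hamiltonian A q y) p = p - A q :=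
  ext_inner_right ℝ fun w => inner_gradient_half_norm_sq ((hasFDerivAt_id p).sub_const (A q)) w

theorem inner_gradient_hamiltonian_position {A : Plane → Plane} {q : Plane}
    (hA : DifferentiableAt ℝ A q) (p w : Plane) :
    inner ℝ (gradient (fun x => hamiltonian A x p) q) w = -inner ℝ (p - A q) (fderiv ℝ A q w) :=
  (inner_gradient_half_norm_sq (hA.hasFDerivAt.const_sub p) w).trans <| by
    rw [neg_apply, inner_neg_right]

theorem IsTrajectory.isMagneticMotion {Ω : Set Plane} {b : Plane → ℝ} {A : Plane → Plane} {T : ℝ}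
    {q p : ℝ → Plane} (hqp : IsTrajectory A T q p) (hA : IsVectorPotential Ω b A) (hΩ : IsOpen Ω)
    (hq : ∀ t ∈ Icc 0 T, q t ∈ Ω) :
    IsMagneticMotion b (Icc 0 T) q fun t => p t - A (q t) := by
  have hq' : ∀ t ∈ Icc 0 T, HasDerivWithinAt q (p t - A (q t)) (Icc 0 T) t := fun t ht => by
    simpa only [gradient_hamiltonian_momentum] using (hqp t ht).1
  refine ⟨hq', fun t ht => ?_⟩
  have hdA : DifferentiableAt ℝ A (q t) :=
    (hA.1.contDiffAt (hΩ.mem_nhds (hq t ht))).differentiableAt one_ne_zero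
  refine ((hqp t ht).2.sub
    (hdA.hasFDerivAt.comp_hasDerivWithinAt t (hq' t ht))).congr_deriv ?_
  refine ext_inner_right ℝ fun w => ?_
  rw [inner_sub_left, inner_neg_left, inner_gradient_hamiltonian_position hdA, neg_neg,
    inner_map_sub_inner_map, hA.2 _ (hq t ht), real_inner_smul_left]

theorem IsMagneticMotion.norm_velocity_eq {b : Plane → ℝ} {I : Set ℝ} {q v : ℝ → Plane}
    (h : IsMagneticMotion b I q v) (hI : Convex ℝ I) {t₀ t : ℝ} (ht₀ : t₀ ∈ I) (ht : t ∈ I) :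
    ‖v t‖ = ‖v t₀‖ := by
  have hderiv : ∀ x ∈ I, HasDerivWithinAt (fun x => ‖v x‖ ^ 2) 0 I x := fun x hx =>
    (h.hasDerivWithinAt_velocity x hx).norm_sq.congr_deriv <| by
      rw [real_inner_smul_right, real_inner_comm, Orientation.inner_rightAngleRotation_self,
        mul_zero, mul_zero]
  have hconst := hI.norm_image_sub_le_of_norm_hasDerivWithin_le hderiv
    (fun _ _ => norm_zero.le) ht₀ ht
  rw [zero_mul, norm_le_zero_iff, sub_eq_zero] at hconst
  exact (sq_eq_sq₀ (norm_nonneg _) (norm_nonneg _)).1 hconst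

end Dynamics

section Curve

/-- A `C²` plane curve parametrized by arc length; it may be open and have self-intersections. -/
structure IsUnitSpeed (γ : ℝ → Plane) : Prop where
  contDiff : ContDiff ℝ 2 γ
  norm_deriv : ∀ s, ‖deriv γ s‖ = 1

theorem IsArcLengthParam.isUnitSpeed {γ : ℝ → Plane} {L : ℝ} {C : Set Plane}
    (hγ : IsArcLengthParam γ L C) : IsUnitSpeed γ :=
  ⟨hγ.contDiff, hγ.unit_speed⟩

theorem normal_eq_quarterTurn (γ : ℝ → Plane) : normal γ = fun s => quarterTurn (deriv γ s) :=
  funext fun _ => (quarterTurn_apply _).symm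

theorem inner_normal_deriv (γ : ℝ → Plane) (s : ℝ) :
    inner ℝ (normal γ s) (deriv γ s) = 0 := by
  rw [normal_eq_quarterTurn, Orientation.inner_rightAngleRotation_self]

variable {γ : ℝ → Plane} {L : ℝ}

theorem deriv_periodic (hper : Function.Periodic γ L) : Function.Periodic (deriv γ) L := fun s => by
  rw [← deriv_comp_add_const, funext hper]

theorem normal_periodic (hper : Function.Periodic γ L) : Function.Periodic (normal γ) L :=
  fun s => by simp only [normal, deriv_periodic hper s]

theorem tube_periodic (hper : Function.Periodic γ L) (n : ℝ) : Function.Periodic (tube γ n) L :=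
  fun s => by simp only [tube, hper s, normal_periodic hper s]

theorem curvature_periodic (hper : Function.Periodic γ L) : Function.Periodic (curvature γ) L :=
  fun s => by
    simp only [curvature, normal_periodic hper s, deriv_periodic (deriv_periodic hper) s]

theorem IsArcLengthParam.tube_mem {Ω C : Set Plane} {δ : ℝ} (hγ : IsArcLengthParam γ L C)
    (htub : IsTubular Ω C γ L δ) {n : ℝ} (hn : n ∈ Ioo 0 δ) (s : ℝ) : tube γ n s ∈ Ω := by
  obtain ⟨s', hs', h⟩ := (tube_periodic hγ.periodic n).exists_mem_Ico₀ hγ.length_pos s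
  exact h ▸ (htub.mapsTo (mk_mem_prod hn hs')).1

namespace IsUnitSpeed

theorem hasDerivAt (hγ : IsUnitSpeed γ) (s : ℝ) : HasDerivAt γ (deriv γ s) s :=
  (hγ.contDiff.differentiable two_ne_zero s).hasDerivAt

theorem contDiff_deriv (hγ : IsUnitSpeed γ) : ContDiff ℝ 1 (deriv γ) :=
  (contDiff_succ_iff_deriv (n := 1)).1 hγ.contDiff |>.2.2

theorem inner_deriv_deriv (hγ : IsUnitSpeed γ) (s : ℝ) :
    inner ℝ (deriv γ s) (deriv (deriv γ) s) = 0 := by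
  have h := (hγ.contDiff_deriv.differentiable one_ne_zero s).hasDerivAt.norm_sq
  simp only [hγ.norm_deriv, one_pow] at h
  linarith [h.unique (hasDerivAt_const s (1 : ℝ))]

theorem hasDerivAt_deriv (hγ : IsUnitSpeed γ) (s : ℝ) :
    HasDerivAt (deriv γ) (curvature γ s • normal γ s) s := by
  have h := eq_inner_smul_quarterTurn (hγ.norm_deriv s) (hγ.inner_deriv_deriv s)
  rw [← congrFun (normal_eq_quarterTurn γ) s] at h
  exact h ▸ (hγ.contDiff_deriv.differentiable one_ne_zero s).hasDerivAt

theorem hasDerivAt_normal (hγ : IsUnitSpeed γ) (s : ℝ) :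
    HasDerivAt (normal γ) (-curvature γ s • deriv γ s) s := by
  rw [normal_eq_quarterTurn]
  refine (quarterTurn.toContinuousLinearEquiv.hasFDerivAt.comp_hasDerivAt s
    (hγ.hasDerivAt_deriv s)).congr_deriv ?_
  simp [normal_eq_quarterTurn]

theorem norm_normal (hγ : IsUnitSpeed γ) (s : ℝ) : ‖normal γ s‖ = 1 := by
  rw [normal_eq_quarterTurn, LinearIsometryEquiv.norm_map, hγ.norm_deriv]

theorem continuous_normal (hγ : IsUnitSpeed γ) : Continuous (normal γ) :=
  continuous_iff_continuousAt.2 fun s => (hγ.hasDerivAt_normal s).continuousAt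

theorem continuous_tube (hγ : IsUnitSpeed γ) : Continuous fun x : ℝ × ℝ => tube γ x.1 x.2 := by
  have hcont := hγ.contDiff.continuous
  have hnormal := hγ.continuous_normal
  unfold tube
  fun_prop

theorem continuous_curvature (hγ : IsUnitSpeed γ) : Continuous (curvature γ) :=
  (hγ.contDiff_deriv.continuous_deriv le_rfl).inner hγ.continuous_normal

theorem abs_curvature_le_iSup (hγ : IsUnitSpeed γ) (hL : 0 < L)
    (hper : Function.Periodic γ L) (s : ℝ) : |curvature γ s| ≤ ⨆ s, |curvature γ s| := by
  have hper' : Function.Periodic (fun s => |curvature γ s|) L :=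
    fun s => congrArg _ (curvature_periodic hper s)
  exact le_ciSup (f := fun s => |curvature γ s|)
    (hper'.compact_of_continuous hL.ne' hγ.continuous_curvature.abs).bddAbove s

theorem abs_mul_curvature_lt (hγ : IsUnitSpeed γ) (hL : 0 < L) (hper : Function.Periodic γ L)
    {ε δ n : ℝ} (hδε : δ ≤ ε / ⨆ s, |curvature γ s|) (hn : n ∈ Ioo 0 δ) (s : ℝ) :
    |n * curvature γ s| < ε := by
  have hK : 0 < ⨆ s, |curvature γ s| := by
    refine (Real.iSup_nonneg fun _ => abs_nonneg _).lt_of_ne fun h => ?_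
    rw [← h, div_zero] at hδε
    exact (hn.1.trans hn.2).not_ge hδε
  rw [abs_mul, abs_of_pos hn.1]
  calc n * |curvature γ s| ≤ n * ⨆ s, |curvature γ s| :=
        mul_le_mul_of_nonneg_left (hγ.abs_curvature_le_iSup hL hper s) hn.1.le
    _ < δ * ⨆ s, |curvature γ s| := mul_lt_mul_of_pos_right hn.2 hK
    _ ≤ ε := (le_div_iff₀ hK).1 hδε

end IsUnitSpeed

end Curve

section TubularCoordinates

variable {γ : ℝ → Plane}

theorem IsUnitSpeed.hasFDerivAt_tube (hγ : IsUnitSpeed γ) (n s : ℝ) :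
    HasFDerivAt (fun x : ℝ × ℝ => tube γ x.1 x.2)
      ((ContinuousLinearMap.fst ℝ ℝ ℝ).smulRight (normal γ s) +
        (ContinuousLinearMap.snd ℝ ℝ ℝ).smulRight ((1 - n * curvature γ s) • deriv γ s))
      (n, s) := by
  have hsnd : HasFDerivAt Prod.snd (ContinuousLinearMap.snd ℝ ℝ ℝ) (n, s) := hasFDerivAt_snd
  have hγ' := (hγ.hasDerivAt s).hasFDerivAt.comp (n, s) hsnd
  have hN := (hγ.hasDerivAt_normal s).hasFDerivAt.comp (n, s) hsnd
  refine (hγ'.add (hasFDerivAt_fst.smul hN)).congr_fderiv ?_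
  refine ContinuousLinearMap.ext fun x => ?_
  simp only [Function.comp_apply, add_apply, smul_apply, ContinuousLinearMap.comp_apply,
    ContinuousLinearMap.smulRight_apply, ContinuousLinearMap.toSpanSingleton_apply,
    ContinuousLinearMap.coe_fst', ContinuousLinearMap.coe_snd']
  module

theorem IsUnitSpeed.inner_normal_tube_sub (hγ : IsUnitSpeed γ) (n s : ℝ) :
    inner ℝ (normal γ s) (tube γ n s - γ s) = n := by
  rw [tube, add_sub_cancel_left, real_inner_smul_right, real_inner_self_eq_norm_sq, hγ.norm_normal,
    one_pow, mul_one]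

/-- `(n, s)` are tubular coordinates around `γ` of the moving point `q`, over the time set `I`.
Here `s` is a continuous lift to `ℝ` of the arc length coordinate. -/
structure HasTubularCoords (γ : ℝ → Plane) (I : Set ℝ) (q : ℝ → Plane) (n s : ℝ → ℝ) : Prop where
  continuousOn : ContinuousOn s I
  eq_tube : ∀ t ∈ I, q t = tube γ (n t) (s t)

namespace HasTubularCoords

variable {I : Set ℝ} {q : ℝ → Plane} {n s : ℝ → ℝ} {t : ℝ}

theorem continuousOn_normalCoord (hc : HasTubularCoords γ I q n s) (hγ : IsUnitSpeed γ)
    (hq : ContinuousOn q I) : ContinuousOn n I := by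
  have hcont : ContinuousOn (fun t => inner ℝ (normal γ (s t)) (q t - γ (s t))) I :=
    (hγ.continuous_normal.comp_continuousOn hc.continuousOn).inner
      (hq.sub (hγ.contDiff.continuous.comp_continuousOn hc.continuousOn))
  refine hcont.congr fun t ht => ?_
  simp only [hc.eq_tube t ht, hγ.inner_normal_tube_sub]

/- The frame `(N, γ')` is orthonormal, so taking inner products with it inverts the differential
of `ψ`; a continuous lift of a differentiable curve through such a map is differentiable. -/
theorem hasDerivWithinAt (hc : HasTubularCoords γ I q n s) (hγ : IsUnitSpeed γ)
    (hq : ContinuousOn q I) (ht : t ∈ I) {w : Plane} (hqt : HasDerivWithinAt q w I t)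
    (hr : 1 - n t * curvature γ (s t) ≠ 0) :
    HasDerivWithinAt (fun t => (n t, s t)) (inner ℝ (normal γ (s t)) w,
      inner ℝ (deriv γ (s t)) w / (1 - n t * curvature γ (s t))) I t := by
  have hcont : Tendsto (fun t => (n t, s t)) (𝓝[I] t) (𝓝[univ] (n t, s t)) := by
    rw [nhdsWithin_univ]
    exact (hc.continuousOn_normalCoord hγ hq t ht).prodMk (hc.continuousOn t ht)
  have hcomp : (fun x : ℝ × ℝ => tube γ x.1 x.2) ∘ (fun t => (n t, s t)) =ᶠ[𝓝[I] t] q :=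
    eventually_mem_nhdsWithin.mono fun x hx => (hc.eq_tube x hx).symm
  have hinv : Function.LeftInverse
      ((innerSL ℝ (normal γ (s t))).prod
        ((1 - n t * curvature γ (s t))⁻¹ • innerSL ℝ (deriv γ (s t))))
      ((ContinuousLinearMap.fst ℝ ℝ ℝ).smulRight (normal γ (s t)) +
        (ContinuousLinearMap.snd ℝ ℝ ℝ).smulRight
          ((1 - n t * curvature γ (s t)) • deriv γ (s t))) := fun x => by
    have hNτ := inner_normal_deriv γ (s t)
    have hτN := real_inner_comm (normal γ (s t)) (deriv γ (s t)) ▸ hNτ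
    simp only [Pi.add_apply, smul_apply, ContinuousLinearMap.prod_apply,
      ContinuousLinearMap.smulRight_apply, ContinuousLinearMap.coe_fst',
      ContinuousLinearMap.coe_snd', innerSL_apply_apply, inner_add_right, real_inner_smul_right,
      real_inner_self_eq_norm_sq, hNτ, hτN, hγ.norm_normal, hγ.norm_deriv, smul_eq_mul]
    refine Prod.ext ?_ ?_ <;> field_simp <;> ring
  refine (HasFDerivWithinAt.of_comp_of_leftInverse hcont (hγ.hasFDerivAt_tube _ _).hasFDerivWithinAt
    hqt.hasFDerivWithinAt hcomp hinv ht).hasDerivWithinAt.congr_deriv ?_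
  simp [div_eq_inv_mul]

end HasTubularCoords

end TubularCoordinates

section Flux

variable {Ω : Set Plane} {b : Plane → ℝ} {γ : ℝ → Plane} {δ : ℝ}

theorem IsUnitSpeed.continuousOn_integral_tubularField (hγ : IsUnitSpeed γ)
    (hstrip : ∀ n ∈ Ioo 0 δ, ∀ s, tube γ n s ∈ Ω) (hb : ContinuousOn b Ω) (L : ℝ) :
    ContinuousOn (fun η => ∫ ξ in (0 : ℝ)..L, tubularField b γ η ξ) (Ioo 0 δ) := by
  rw [continuousOn_iff_continuous_domRestrict]
  refine intervalIntegral.continuous_parametric_intervalIntegral_of_continuous'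
    (f := fun (η : Ioo 0 δ) ξ => tubularField b γ η ξ) ?_ 0 L
  have hκ := hγ.continuous_curvature
  have htube : Continuous fun x : Ioo 0 δ × ℝ => tube γ x.1 x.2 :=
    hγ.continuous_tube.comp (g := fun x : ℝ × ℝ => tube γ x.1 x.2)
      (f := fun x : Ioo 0 δ × ℝ => ((x.1 : ℝ), x.2)) (by fun_prop)
  exact (hb.comp_continuous htube fun x => hstrip x.1 x.1.2 x.2).neg.mul (by fun_prop)

theorem IsUnitSpeed.hasDerivAt_flux (hγ : IsUnitSpeed γ)
    (hstrip : ∀ n ∈ Ioo 0 δ, ∀ s, tube γ n s ∈ Ω) (hb : ContinuousOn b Ω) {L n : ℝ}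
    (hn : n ∈ Ioo 0 δ)
    (hint : IntervalIntegrable (fun η => ∫ ξ in (0 : ℝ)..L, tubularField b γ η ξ) volume n δ) :
    HasDerivAt (flux b γ L δ) (1 / L * ∫ ξ in (0 : ℝ)..L, tubularField b γ n ξ) n := by
  have hcont := hγ.continuousOn_integral_tubularField hstrip hb L
  exact ((intervalIntegral.integral_hasDerivAt_left hint
    (hcont.stronglyMeasurableAtFilter isOpen_Ioo n hn)
    (hcont.continuousAt (isOpen_Ioo.mem_nhds hn))).const_mul (-(1 / L))).congr_deriv
      (neg_mul_neg _ _)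

end Flux

section FluxMomentum

variable {b : Plane → ℝ} {γ : ℝ → Plane} {L δ : ℝ}

/-- The approximately conserved quantity of the motion: the angular momentum `s' (1 - n κ)²` of
a particle with tubular coordinates `(n, s)` and velocity `w`, plus the flux `f(n)`. It is
expressed through the tangential velocity `⟪γ', w⟫ = s' (1 - n κ)`. -/
def fluxMomentum (b : Plane → ℝ) (γ : ℝ → Plane) (L δ n s : ℝ) (w : Plane) : ℝ :=
  inner ℝ (deriv γ s) w * (1 - n * curvature γ s) + flux b γ L δ n

theorem IsUnitSpeed.abs_inner_deriv_le (hγ : IsUnitSpeed γ) (s : ℝ) (w : Plane) :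
    |inner ℝ (deriv γ s) w| ≤ ‖w‖ := by
  simpa only [hγ.norm_deriv, one_mul] using abs_real_inner_le_norm (deriv γ s) w

theorem IsUnitSpeed.abs_inner_normal_le (hγ : IsUnitSpeed γ) (s : ℝ) (w : Plane) :
    |inner ℝ (normal γ s) w| ≤ ‖w‖ := by
  simpa only [hγ.norm_normal, one_mul] using abs_real_inner_le_norm (normal γ s) w

theorem IsUnitSpeed.abs_flux_le (hγ : IsUnitSpeed γ) (b : Plane → ℝ) (L δ n s : ℝ) (w : Plane) :
    |flux b γ L δ n| ≤ |fluxMomentum b γ L δ n s w| + ‖w‖ * (1 + |n * curvature γ s|) := by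
  have hr : |1 - n * curvature γ s| ≤ 1 + |n * curvature γ s| := by
    simpa only [abs_one] using abs_sub (1 : ℝ) (n * curvature γ s)
  calc |flux b γ L δ n|
      = |fluxMomentum b γ L δ n s w - inner ℝ (deriv γ s) w * (1 - n * curvature γ s)| := by
        rw [fluxMomentum, add_sub_cancel_left]
    _ ≤ |fluxMomentum b γ L δ n s w| + |inner ℝ (deriv γ s) w * (1 - n * curvature γ s)| :=
        abs_sub _ _
    _ ≤ |fluxMomentum b γ L δ n s w| + ‖w‖ * (1 + |n * curvature γ s|) := by
        rw [abs_mul]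
        gcongr
        exact hγ.abs_inner_deriv_le s w

theorem confinementConst_eq (b : Plane → ℝ) (γ : ℝ → Plane) (L δ ε M H₀ n₀ s₀ T : ℝ) (w : Plane)
    (hr : 1 - n₀ * curvature γ s₀ ≠ 0) :
    confinementConst b γ L δ ε M H₀ n₀ s₀
        (inner ℝ (deriv γ s₀) w / (1 - n₀ * curvature γ s₀)) T =
      |fluxMomentum b γ L δ n₀ s₀ w| + √(2 * H₀) * (1 + ε) +
        (M * √(2 * H₀) + 2 * H₀ * (⨆ s, |deriv (curvature γ) s|) * δ / (1 - ε)) * T := by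
  rw [confinementConst, fluxMomentum, flux, neg_mul, ← sub_eq_add_neg, mul_comm (curvature γ s₀),
    sq, ← mul_assoc, div_mul_cancel₀ _ hr]

variable {I : Set ℝ} {q v : ℝ → Plane} {n s : ℝ → ℝ} {t : ℝ}

namespace IsMagneticMotion

theorem hasDerivWithinAt_coords (h : IsMagneticMotion b I q v)
    (hc : HasTubularCoords γ I q n s) (hγ : IsUnitSpeed γ) (ht : t ∈ I)
    (hr : 1 - n t * curvature γ (s t) ≠ 0) :
    HasDerivWithinAt n (inner ℝ (normal γ (s t)) (v t)) I t ∧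
      HasDerivWithinAt s
        (inner ℝ (deriv γ (s t)) (v t) / (1 - n t * curvature γ (s t))) I t := by
  have hq : ContinuousOn q I := fun x hx => (h.hasDerivWithinAt_position x hx).continuousWithinAt
  have hns := hc.hasDerivWithinAt hγ hq ht (h.hasDerivWithinAt_position t ht) hr
  exact ⟨(ContinuousLinearMap.fst ℝ ℝ ℝ).hasFDerivAt.comp_hasDerivWithinAt t hns,
    (ContinuousLinearMap.snd ℝ ℝ ℝ).hasFDerivAt.comp_hasDerivWithinAt t hns⟩

theorem hasDerivWithinAt_inner_deriv (h : IsMagneticMotion b I q v) (hγ : IsUnitSpeed γ)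
    (ht : t ∈ I) {s' : ℝ} (hs : HasDerivWithinAt s s' I t) :
    HasDerivWithinAt (fun t => inner ℝ (deriv γ (s t)) (v t))
      ((b (q t) + s' * curvature γ (s t)) * inner ℝ (normal γ (s t)) (v t)) I t := by
  have hτ := (hγ.hasDerivAt_deriv (s t)).scomp_hasDerivWithinAt t hs
  refine (hτ.inner ℝ (h.hasDerivWithinAt_velocity t ht)).congr_deriv ?_
  have hJ : inner ℝ (deriv γ (s t)) (quarterTurn (v t)) = -inner ℝ (normal γ (s t)) (v t) := by
    rw [normal_eq_quarterTurn, Orientation.inner_rightAngleRotation_left,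
      Orientation.inner_rightAngleRotation_right]
  simp only [Function.comp_apply, real_inner_smul_left, real_inner_smul_right, hJ]
  ring

theorem hasDerivWithinAt_fluxMomentum (h : IsMagneticMotion b I q v)
    (hc : HasTubularCoords γ I q n s) (hγ : IsUnitSpeed γ)
    (hκ : Differentiable ℝ (curvature γ)) (ht : t ∈ I)
    (hflux : HasDerivAt (flux b γ L δ) (1 / L * ∫ ξ in (0 : ℝ)..L, tubularField b γ (n t) ξ) (n t))
    (hr : 1 - n t * curvature γ (s t) ≠ 0) :
    HasDerivWithinAt (fun t => fluxMomentum b γ L δ (n t) (s t) (v t))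
      (-((tubularField b γ (n t) (s t) - 1 / L * ∫ ξ in (0 : ℝ)..L, tubularField b γ (n t) ξ) *
          inner ℝ (normal γ (s t)) (v t)) -
        n t * deriv (curvature γ) (s t) * inner ℝ (deriv γ (s t)) (v t) ^ 2 /
          (1 - n t * curvature γ (s t))) I t := by
  obtain ⟨hn', hs'⟩ := h.hasDerivWithinAt_coords hc hγ ht hr
  have hu' := h.hasDerivWithinAt_inner_deriv hγ ht hs'
  have hκ' := (hκ (s t)).hasDerivAt.comp_hasDerivWithinAt t hs'
  refine ((hu'.mul ((hn'.mul hκ').const_sub 1)).add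
    (hflux.comp_hasDerivWithinAt t hn')).congr_deriv ?_
  simp only [tubularField, ← hc.eq_tube t ht, Function.comp_apply, Pi.mul_apply]
  field_simp
  ring

theorem abs_fluxMomentum_sub_le (h : IsMagneticMotion b I q v)
    (hc : HasTubularCoords γ I q n s) (hγ : IsUnitSpeed γ) (hI : Convex ℝ I)
    (hκ : Differentiable ℝ (curvature γ))
    (hκ' : BddAbove (range fun s => |deriv (curvature γ) s|))
    (hn : ∀ t ∈ I, n t ∈ Ioo 0 δ)
    (hflux : ∀ n ∈ Ioo 0 δ,
      HasDerivAt (flux b γ L δ) (1 / L * ∫ ξ in (0 : ℝ)..L, tubularField b γ n ξ) n)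
    {ε M V : ℝ} (hε : ε < 1) (hnκ : ∀ t ∈ I, |n t * curvature γ (s t)| ≤ ε)
    (hBM : ∀ n ∈ Ioo 0 δ, ∀ s : ℝ,
      |tubularField b γ n s - 1 / L * ∫ ξ in (0 : ℝ)..L, tubularField b γ n ξ| ≤ M)
    (hV : ∀ t ∈ I, ‖v t‖ ≤ V) {t₀ : ℝ} (ht₀ : t₀ ∈ I) (ht : t ∈ I) :
    |fluxMomentum b γ L δ (n t) (s t) (v t) - fluxMomentum b γ L δ (n t₀) (s t₀) (v t₀)| ≤
      (M * V + V ^ 2 * (⨆ s, |deriv (curvature γ) s|) * δ / (1 - ε)) * |t - t₀| := by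
  have hr : ∀ x ∈ I, 1 - ε ≤ 1 - n x * curvature γ (s x) := fun x hx =>
    sub_le_sub_left (abs_le.1 (hnκ x hx)).2 1
  have hr₀ : ∀ x ∈ I, 0 < 1 - n x * curvature γ (s x) := fun x hx =>
    (sub_pos.2 hε).trans_le (hr x hx)
  refine hI.norm_image_sub_le_of_norm_hasDerivWithin_le (fun x hx =>
    h.hasDerivWithinAt_fluxMomentum hc hγ hκ hx (hflux _ (hn x hx)) (hr₀ x hx).ne')
    (fun x hx => ?_) ht₀ ht
  have hu := (hγ.abs_inner_deriv_le (s x) (v x)).trans (hV x hx)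
  have hw := (hγ.abs_inner_normal_le (s x) (v x)).trans (hV x hx)
  have hδ : n x * |deriv (curvature γ) (s x)| ≤ δ * ⨆ s, |deriv (curvature γ) s| :=
    mul_le_mul (hn x hx).2.le (le_ciSup hκ' (s x)) (abs_nonneg _)
      ((hn x hx).1.trans (hn x hx).2).le
  refine (abs_sub _ _).trans (add_le_add ?_ ?_)
  · rw [abs_neg, abs_mul]
    exact mul_le_mul (hBM _ (hn x hx) _) hw (abs_nonneg _)
      ((abs_nonneg _).trans (hBM _ (hn x hx) (s x)))
  · rw [abs_div, abs_of_pos (hr₀ x hx), abs_mul, abs_mul, abs_of_pos (hn x hx).1, abs_pow,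
      mul_assoc (V ^ 2), mul_comm (V ^ 2), mul_comm _ δ]
    have hδ₀ := (mul_nonneg (hn x hx).1.le (abs_nonneg _)).trans hδ
    exact div_le_div₀ (by positivity) (mul_le_mul hδ (pow_le_pow_left₀ (abs_nonneg _) hu 2)
      (by positivity) hδ₀) (sub_pos.2 hε) (hr x hx)

theorem abs_flux_add_le_confinementConst {T : ℝ} (h : IsMagneticMotion b (Icc 0 T) q v)
    (hc : HasTubularCoords γ (Icc 0 T) q n s) (hγ : IsUnitSpeed γ)
    (hκ : Differentiable ℝ (curvature γ))
    (hκ' : BddAbove (range fun s => |deriv (curvature γ) s|))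
    (hn : ∀ t ∈ Icc 0 T, n t ∈ Ioo 0 δ)
    (hflux : ∀ n ∈ Ioo 0 δ,
      HasDerivAt (flux b γ L δ) (1 / L * ∫ ξ in (0 : ℝ)..L, tubularField b γ n ξ) n)
    {ε M H₀ : ℝ} (hε : ε < 1) (hnκ : ∀ t ∈ Icc 0 T, |n t * curvature γ (s t)| ≤ ε)
    (hBM : ∀ n ∈ Ioo 0 δ, ∀ s : ℝ,
      |tubularField b γ n s - 1 / L * ∫ ξ in (0 : ℝ)..L, tubularField b γ n ξ| ≤ M)
    (hT : 0 < T) (hH₀ : ‖v 0‖ ^ 2 / 2 = H₀) (ht : t ∈ Icc 0 T) :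
    |flux b γ L δ (n t)| + √(2 * H₀) * (ε - |n t * curvature γ (s t)|) ≤
      confinementConst b γ L δ ε M H₀ (n 0) (s 0) (derivWithin s (Icc 0 T) 0) T := by
  have h0 : (0 : ℝ) ∈ Icc 0 T := left_mem_Icc.2 hT.le
  have hr : 1 - n 0 * curvature γ (s 0) ≠ 0 :=
    (sub_pos.2 ((abs_le.1 (hnκ 0 h0)).2.trans_lt hε)).ne'
  have hs₀ := (h.hasDerivWithinAt_coords hc hγ h0 hr).2.derivWithin (uniqueDiffOn_Icc hT 0 h0)
  have hH : 2 * H₀ = ‖v 0‖ ^ 2 := by rw [← hH₀, mul_div_cancel₀ _ two_ne_zero]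
  have hspeed : ∀ x ∈ Icc 0 T, ‖v x‖ = ‖v 0‖ := fun x hx =>
    h.norm_velocity_eq (convex_Icc 0 T) h0 hx
  have hdrift := h.abs_fluxMomentum_sub_le hc hγ (convex_Icc 0 T) hκ hκ' hn hflux hε hnκ hBM
    (fun x hx => (hspeed x hx).le) h0 ht
  have hrate : 0 ≤ M * ‖v 0‖ + ‖v 0‖ ^ 2 * (⨆ s, |deriv (curvature γ) s|) * δ / (1 - ε) := by
    have hδ : 0 < δ := (hn 0 h0).1.trans (hn 0 h0).2
    have hM : 0 ≤ M := (abs_nonneg _).trans (hBM _ (hn 0 h0) (s 0))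
    have hK' : 0 ≤ ⨆ s, |deriv (curvature γ) s| := Real.iSup_nonneg fun _ => abs_nonneg _
    exact add_nonneg (by positivity) (div_nonneg (by positivity) (sub_pos.2 hε).le)
  have hmom := hγ.abs_flux_le b L δ (n t) (s t) (v t)
  rw [hs₀, confinementConst_eq _ _ _ _ _ _ _ _ _ _ _ hr, hH, Real.sqrt_sq (norm_nonneg _)]
  rw [sub_zero, abs_of_nonneg ht.1] at hdrift
  rw [hspeed t ht] at hmom
  linarith [abs_sub_abs_le_abs_sub (fluxMomentum b γ L δ (n t) (s t) (v t))
    (fluxMomentum b γ L δ (n 0) (s 0) (v 0)), mul_le_mul_of_nonneg_left ht.2 hrate]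

end IsMagneticMotion

end FluxMomentum

end

end MagneticConfinement

theorem theorem2p2_general {Ω : Set Plane} (hΩ : IsOpen Ω)
    {γ : ℝ → Plane} (hγ : IsUnitSpeed γ) {L : ℝ} (hL : 0 < L) (hper : Function.Periodic γ L)
    (hκ : Differentiable ℝ (curvature γ))
    (hκ' : BddAbove (range fun s => |deriv (curvature γ) s|))
    {b : Plane → ℝ} {A : Plane → Plane} (hA : IsVectorPotential Ω b A)
    {ε : ℝ} (hε : ε < 1) {δ : ℝ} (hδε : δ ≤ ε / ⨆ s, |curvature γ s|)
    (hstrip : ∀ n ∈ Ioo 0 δ, ∀ s, tube γ n s ∈ Ω)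
    (hint : ∀ n ∈ Ioo 0 δ, IntervalIntegrable
      (fun η => ∫ ξ in (0 : ℝ)..L, tubularField b γ η ξ) volume n δ)
    {M : ℝ} (hBM : ∀ n ∈ Ioo 0 δ, ∀ s : ℝ,
      |tubularField b γ n s - 1 / L * ∫ ξ in (0 : ℝ)..L, tubularField b γ n ξ| ≤ M)
    {T : ℝ} (hT : 0 < T) {q p : ℝ → Plane} (hqp : IsTrajectory A T q p)
    {n s : ℝ → ℝ} (hn : ∀ t ∈ Icc 0 T, n t ∈ Ioo 0 δ)
    (hc : HasTubularCoords γ (Icc 0 T) q n s)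
    {H₀ : ℝ} (hH₀ : hamiltonian A (q 0) (p 0) = H₀)
    {CT : ℝ} (hCT : CT = confinementConst b γ L δ ε M H₀ (n 0) (s 0)
      (derivWithin s (Icc 0 T) 0) T)
    (hlim : (CT : EReal) < liminfFlux b γ L δ) :
    (∃ g : ℝ → ℝ, IsMinorant b γ L δ g) ∧
    ∀ g : ℝ → ℝ, IsMinorant b γ L δ g →
      ∃ m ∈ Ioc 0 δ, g m = CT ∧
        ∀ t ∈ Ico 0 T, m ≤ n t ∧ (0 < H₀ → m < n t) := by
  have hmotion := hqp.isMagneticMotion hA hΩ fun t ht =>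
    hc.eq_tube t ht ▸ hstrip _ (hn t ht) (s t)
  have hnκ : ∀ t ∈ Icc 0 T, |n t * curvature γ (s t)| < ε := fun t ht =>
    hγ.abs_mul_curvature_lt hL hper hδε (hn t ht) (s t)
  have hflux : ∀ t ∈ Icc 0 T,
      |flux b γ L δ (n t)| + √(2 * H₀) * (ε - |n t * curvature γ (s t)|) ≤ CT := fun t ht =>
    hCT ▸ hmotion.abs_flux_add_le_confinementConst hc hγ hκ hκ' hn
      (fun x hx => hγ.hasDerivAt_flux hstrip (hA.continuousOn hΩ) hx (hint x hx)) hε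
      (fun x hx => (hnκ x hx).le) hBM hT hH₀ ht
  have hle : ∀ t ∈ Icc 0 T, |flux b γ L δ (n t)| ≤ CT := fun t ht =>
    (le_add_of_nonneg_right (mul_nonneg (Real.sqrt_nonneg _)
      (sub_pos.2 (hnκ t ht)).le)).trans (hflux t ht)
  have hlt : 0 < H₀ → ∀ t ∈ Icc 0 T, |flux b γ L δ (n t)| < CT := fun hH t ht =>
    (lt_add_of_pos_right _ (mul_pos (Real.sqrt_pos.2 (mul_pos two_pos hH))
      (sub_pos.2 (hnκ t ht)))).trans_le (hflux t ht)
  have h0 : (0 : ℝ) ∈ Icc 0 T := left_mem_Icc.2 hT.le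
  refine ⟨exists_isMinorant b γ L δ, fun g hg => ?_⟩
  obtain ⟨m, hm, rfl⟩ := hg.exists_eq ((hn 0 h0).1.trans (hn 0 h0).2)
    ((abs_nonneg _).trans (hle 0 h0)) hlim
  have hnt : ∀ t ∈ Icc 0 T, n t ∈ Ioc 0 δ := fun t ht => Ioo_subset_Ioc_self (hn t ht)
  refine ⟨m, hm, rfl, fun t ht => ?_⟩
  have ht' := Ico_subset_Icc_self ht
  exact ⟨hg.le_of_abs_flux_le hm (hnt t ht') (hle t ht'),
    fun hH => hg.lt_of_abs_flux_lt hm (hnt t ht') (hlt hH t ht')⟩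

theorem theorem2p2
    -- the domain, one boundary component and its arc length parametrization
    (Ω : Set Plane) (hΩ : IsOpen Ω)
    (C : Set Plane) (hC : IsBoundaryComponent Ω C)
    (γ : ℝ → Plane) (L : ℝ) (hγ : IsArcLengthParam γ L C)
    (hκ : Differentiable ℝ (curvature γ))
    (hκ' : BddAbove (range fun s => |deriv (curvature γ) s|))
    -- the magnetic field and a vector potential
    (b : Plane → ℝ) (hb : LocallyLipschitzOn Ω b)
    (A : Plane → Plane) (hA : IsVectorPotential Ω b A)
    -- the collar
    (ε : ℝ) (hε : ε ∈ Ioo (0 : ℝ) 1)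
    (δ : ℝ) (hδ : 0 < δ) (hδε : δ ≤ ε / ⨆ s, |curvature γ s|)
    (htub : IsTubular Ω C γ L δ)
    -- the integrals defining `f` converge
    (hint : ∀ n ∈ Ioo 0 δ, IntervalIntegrable
      (fun η => ∫ ξ in (0 : ℝ)..L, tubularField b γ η ξ) volume n δ)
    (M : ℝ) (hM : 0 ≤ M)
    (hBM : ∀ n ∈ Ioo 0 δ, ∀ s : ℝ,
      |tubularField b γ n s - (1 / L) * ∫ ξ in (0 : ℝ)..L, tubularField b γ n ξ| ≤ M)
    -- a trajectory in the collar, with its tubular coordinates (`s` is a continuous lift to `ℝ`)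
    (T : ℝ) (hT : 0 < T)
    (q p : ℝ → Plane) (hqp : IsTrajectory A T q p)
    (hq : ∀ t ∈ Icc 0 T, q t ∈ collar Ω C δ)
    (n s : ℝ → ℝ) (hn : ∀ t ∈ Icc 0 T, n t ∈ Ioo 0 δ) (hs : ContinuousOn s (Icc 0 T))
    (hns : ∀ t ∈ Icc 0 T, q t = tube γ (n t) (s t))
    (H₀ : ℝ) (hH₀ : hamiltonian A (q 0) (p 0) = H₀)
    (CT : ℝ) (hCT : CT = confinementConst b γ L δ ε M H₀ (n 0) (s 0)
      (derivWithin s (Icc 0 T) 0) T)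
    (hlim : (CT : EReal) < liminfFlux b γ L δ) :
    (∃ g : ℝ → ℝ, IsMinorant b γ L δ g) ∧
    ∀ g : ℝ → ℝ, IsMinorant b γ L δ g →
      ∃ m ∈ Ioc 0 δ, g m = CT ∧
        ∀ t ∈ Ico 0 T, m ≤ n t ∧ (0 < H₀ → m < n t) := by
  exact theorem2p2_general hΩ hγ.isUnitSpeed hγ.length_pos hγ.periodic hκ hκ' hA hε.2 hδε
    (fun _ => hγ.tube_mem htub) hint hBM hT hqp hn ⟨hs, hns⟩ hH₀ hCT hlim
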